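/- There is an absolute constant $C>0$ such that the following holds for every finite simple undirected connected graph $G=(V,E)$ with $n=|V|\ge 2$ vertices, $m=|E|$ edges and minimum degree $d_{\min}$, and for every integer $k\ge 1$. Consider the lazy random walk on $G$, which at each step stays at its current vertex with probability $1/2$ and otherwise moves to a uniformly random neighbour. Let $\pi(v)=\deg(v)/(2m)$ be its stationary distribution, and let $t_{\mathrm{rel}}=1/(1-\lambda_2)$ be its relaxation time, where $\lambda_2$ is the second largest eigenvalue, counted with multiplicity, of its transition matrix. Let $t_{\mathrm{cov}}^{(k)}(\pi)$ be the expected first time at which every vertex has been visited by at least one of $k$ independent lazy random walks whose start vertices are sampled independently from $\pi$. Then $$t_{\mathrm{cov}}^{(k)}(\pi)\;\le\; C\,\frac{m}{k\,d_{\min}}\,\sqrt{t_{\mathrm{rel}}}\,\log n .$$ -/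

import Mathlib

open MeasureTheory ProbabilityTheory
open scoped ENNReal

noncomputable section

namespace MultiWalk

universe u

section

variable {V : Type u} [Fintype V] [DecidableEq V]

/-- Transition matrix of the lazy random walk on `G`: stay put with probability `1/2`, otherwise
move to a uniformly chosen neighbour. (At an isolated vertex the walk stays put forever; this never
happens in a connected graph with at least two vertices.) -/
def lazyMatrix (G : SimpleGraph V) [DecidableRel G.Adj] : Matrix V V ℝ :=
  Matrix.of fun u v =>
    if u = v then (if G.degree u = 0 then 1 else 1 / 2)
    else if G.Adj u v then 1 / (2 * (G.degree u : ℝ)) else 0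

lemma lazyMatrix_nonneg (G : SimpleGraph V) [DecidableRel G.Adj] (u v : V) :
    0 ≤ lazyMatrix G u v := by
  simp only [lazyMatrix, Matrix.of_apply]
  split_ifs <;> positivity

lemma lazyMatrix_row_sum (G : SimpleGraph V) [DecidableRel G.Adj] (u : V) :
    ∑ v, lazyMatrix G u v = 1 := by
  have key : ∀ v, lazyMatrix G u v
      = (if u = v then (if G.degree u = 0 then (1 : ℝ) else 1 / 2) else 0)
        + (if G.Adj u v then 1 / (2 * (G.degree u : ℝ)) else 0) := by
    intro v
    by_cases h : u = v
    · subst h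
      simp [lazyMatrix]
    · simp [lazyMatrix, h]
  rw [Finset.sum_congr rfl fun v _ => key v, Finset.sum_add_distrib, Finset.sum_ite_eq,
    ← Finset.sum_filter, Finset.sum_const, ← SimpleGraph.neighborFinset_eq_filter,
    SimpleGraph.card_neighborFinset_eq_degree]
  by_cases h : G.degree u = 0
  · simp [h]
  · have h' : (G.degree u : ℝ) ≠ 0 := by exact_mod_cast h
    simp only [Finset.mem_univ, if_true, h, if_false, nsmul_eq_mul]
    field_simp
    norm_num

/-- The law of one step of the lazy random walk from `u`. -/
def lazyStep (G : SimpleGraph V) [DecidableRel G.Adj] (u : V) : PMF V :=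
  PMF.ofFintype (fun v => ENNReal.ofReal (lazyMatrix G u v)) (by
    rw [← ENNReal.ofReal_sum_of_nonneg fun v _ => lazyMatrix_nonneg G u v,
      lazyMatrix_row_sum, ENNReal.ofReal_one])

/-- The eigenvalues of the transition matrix of the lazy walk, with multiplicity, in decreasing
order (for this reversible chain all of them are real). -/
def lazyEigenvalues (G : SimpleGraph V) [DecidableRel G.Adj] : List ℝ :=
  (lazyMatrix G).charpoly.roots.sort (· ≥ ·)

/-- The second largest eigenvalue `λ₂` of the transition matrix of the lazy walk
(the default value is only used if there is at most one vertex). -/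
def lambdaTwo (G : SimpleGraph V) [DecidableRel G.Adj] : ℝ :=
  (lazyEigenvalues G).getD 1 0

/-- The relaxation time `t_rel = 1 / (1 - λ₂)`. -/
def relaxationTime (G : SimpleGraph V) [DecidableRel G.Adj] : ℝ :=
  1 / (1 - lambdaTwo G)

/-- The stationary distribution `π(v) = d(v) / (2m)`. -/
def stationary (G : SimpleGraph V) [DecidableRel G.Adj] (v : V) : ℝ≥0∞ :=
  (G.degree v : ℝ≥0∞) / (2 * (G.edgeFinset.card : ℝ≥0∞))

variable [MeasurableSpace V] [DiscreteMeasurableSpace V]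

/-- The one-step Markov kernel of the lazy random walk. -/
def lazyKernel (G : SimpleGraph V) [DecidableRel G.Adj] : Kernel V V where
  toFun u := (lazyStep G u).toMeasure
  measurable' := Measurable.of_discrete

instance (G : SimpleGraph V) [DecidableRel G.Adj] : IsMarkovKernel (lazyKernel G) :=
  ⟨fun u => inferInstanceAs (IsProbabilityMeasure (lazyStep G u).toMeasure)⟩

/-- The law of `X_{t+1}` given the history `X_0, …, X_t`: one lazy step from `X_t`. -/
def historyKernel (G : SimpleGraph V) [DecidableRel G.Adj] (t : ℕ) :
    Kernel (Finset.Iic t → V) V :=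
  (lazyKernel G).comap (fun x => x ⟨t, Finset.mem_Iic.2 le_rfl⟩) (measurable_pi_apply _)

instance (G : SimpleGraph V) [DecidableRel G.Adj] (t : ℕ) :
    IsMarkovKernel (historyKernel G t) :=
  inferInstanceAs (IsMarkovKernel (Kernel.comap _ _ _))

/-- The law, on the space `ℕ → V` of trajectories, of the lazy random walk started at `u`. -/
def walkLaw (G : SimpleGraph V) [DecidableRel G.Adj] (u : V) : Measure (ℕ → V) :=
  Kernel.traj (X := fun _ => V) (historyKernel G) 0 (fun _ => u)

/-- The law of `k` independent lazy random walks started at `u 0, …, u (k-1)`. -/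
def multiWalkLaw (G : SimpleGraph V) [DecidableRel G.Adj] {k : ℕ} (u : Fin k → V) :
    Measure (Fin k → ℕ → V) :=
  Measure.pi fun i => walkLaw G (u i)

end

section

variable {V : Type u}

/-- The first time at which every vertex has been visited by at least one of the `k` trajectories
(`⊤` if this never happens). -/
def coverTime {k : ℕ} (x : Fin k → ℕ → V) : ℕ∞ :=
  sInf {T : ℕ∞ | ∃ t : ℕ, T = t ∧ ∀ v : V, ∃ i : Fin k, ∃ s ≤ t, x i s = v}

variable [Fintype V] [DecidableEq V] [MeasurableSpace V] [DiscreteMeasurableSpace V]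

/-- The expected cover time of `k` independent lazy walks started at `u 0, …, u (k-1)`. -/
def expectedCoverTimeFrom (G : SimpleGraph V) [DecidableRel G.Adj] {k : ℕ} (u : Fin k → V) :
    ℝ≥0∞ :=
  ∫⁻ x, ((coverTime x : ℕ∞) : ℝ≥0∞) ∂(multiWalkLaw G u)

/-- The expected cover time of `k` independent lazy walks whose start vertices are sampled
independently from the distribution `μ`. -/
def expectedCoverTime (G : SimpleGraph V) [DecidableRel G.Adj] (k : ℕ) (μ : V → ℝ≥0∞) : ℝ≥0∞ :=
  ∑ u : Fin k → V, (∏ i, μ (u i)) * expectedCoverTimeFrom G u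

end

end MultiWalk

end

namespace MultiWalk

/-! Everything rests on a spectral gap for the lazy walk killed at a vertex `v`: it is at least of
order `d_min / (m √t_rel)`. Then a stationary walk avoids `v` up to time `t` with probability at
most `exp (-hitRate G * (t + 1))`, and `k` independent walks all avoid it with the `k`-th power of
this. A union bound over the `n` vertices and summation of `min 1 (n exp (-k * hitRate G * (t +
1)))` over `t` give `(1 + log n) / (k * hitRate G)`.

The square root comes from `minDegree_sq_le_of_mean_one`. Let `f v = 0`, let `f` have stationary
mean one, and let `D` be its energy. Cauchy–Schwarz along geodesics keeps `f` at most `1/2` on the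
ball of radius about `1/(4D)` around `v`. This ball has at least about `d_min / D` vertices, hence
degree mass of order `d_min ^ 2 / D`, and on it `f` is far from its mean. The Poincaré inequality
bounds the variance by `t_rel * D`, so `d_min ^ 2` is at most of order `t_rel * D ^ 2`, and a square
root gives `D` at least of order `d_min / √t_rel`.

By scaling, this bounds the difference between any value of a function and its mean, hence between
any two values, by its energy. Summing over vertices gives the killed gap
(`minDegree_mul_sum_sq_le`). Reversibility and laziness turn the gap into decay of the avoidance
probability at every single step (`sum_degree_mul_survival_succ_le`). -/

lemma exists_geodesic {V : Type*} {G : SimpleGraph V} (hG : G.Connected) (v w : V) :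
    ∃ x : ℕ → V, x 0 = v ∧ x (G.dist v w) = w ∧
      (∀ i < G.dist v w, G.Adj (x i) (x (i + 1))) ∧ ∀ i ≤ G.dist v w, G.dist v (x i) = i := by
  obtain ⟨p, hp⟩ := hG.exists_walk_length_eq_dist v w
  refine ⟨p.getVert, by simp, by rw [← hp]; simp, fun i hi => p.adj_getVert_succ (hp ▸ hi), ?_⟩
  intro i hi
  have h1 : G.dist v (p.getVert i) ≤ i :=
    (SimpleGraph.dist_le (p.take i)).trans (by simp [SimpleGraph.Walk.take_length])
  have h2 : G.dist (p.getVert i) w ≤ p.length - i :=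
    (SimpleGraph.dist_le (p.drop i)).trans (by simp [SimpleGraph.Walk.drop_length])
  have h3 := hG.dist_triangle (u := v) (v := p.getVert i) (w := w)
  omega

/-! ### Dirichlet energy, growth of balls, and the energy lower bound. -/

section Energy

variable {V : Type*} [Fintype V] (G : SimpleGraph V) [DecidableRel G.Adj]

/-- The sum of `(f x - f y) ^ 2` over ordered pairs of adjacent vertices. -/
noncomputable def gradSq (f : V → ℝ) : ℝ :=
  ∑ x, ∑ y, if G.Adj x y then (f x - f y) ^ 2 else 0

lemma gradSq_nonneg (f : V → ℝ) : 0 ≤ gradSq G f :=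
  Finset.sum_nonneg fun x _ => Finset.sum_nonneg fun y _ => by split_ifs <;> positivity

lemma gradSq_sub_const (f : V → ℝ) (c : ℝ) : gradSq G (fun x => f x - c) = gradSq G f := by
  simp [gradSq]

lemma gradSq_mul_const (f : V → ℝ) (c : ℝ) :
    gradSq G (fun x => f x * c) = c ^ 2 * gradSq G f := by
  simp only [gradSq, Finset.mul_sum]
  refine Finset.sum_congr rfl fun x _ => Finset.sum_congr rfl fun y _ => ?_
  split_ifs <;> ring

variable {G}

lemma sum_neighbor_sq_le (f : V → ℝ) (v : V) :
    (∑ y, if G.Adj v y then (f v - f y) ^ 2 else 0) ≤ gradSq G f :=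
  Finset.single_le_sum (f := fun x => ∑ y, if G.Adj x y then (f x - f y) ^ 2 else 0)
    (fun x _ => Finset.sum_nonneg fun y _ => by split_ifs <;> positivity) (Finset.mem_univ v)

/-- Telescoping and Cauchy–Schwarz along a geodesic. Its vertices are distinct, so each squared
increment is charged to a different row of `gradSq`. -/
lemma sq_le_dist_mul_gradSq (hG : G.Connected) (f : V → ℝ) (v w : V) :
    (f w - f v) ^ 2 ≤ G.dist v w * gradSq G f := by
  obtain ⟨x, h0, hL, hadj, hdist⟩ := exists_geodesic hG v w
  set L := G.dist v w with hLdef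
  have htel : f w - f v = ∑ i ∈ Finset.range L, (f (x (i + 1)) - f (x i)) := by
    rw [Finset.sum_range_sub (fun i => f (x i)), hL, h0]
  have hcs := sq_sum_le_card_mul_sum_sq (s := Finset.range L)
    (f := fun i => f (x (i + 1)) - f (x i))
  rw [Finset.card_range, ← htel] at hcs
  refine hcs.trans (mul_le_mul_of_nonneg_left ?_ (Nat.cast_nonneg _))
  have hinj : Set.InjOn x (Finset.range L : Set ℕ) := by
    intro i hi j hj hij
    have hi' := hdist i (by simp at hi; omega)
    have hj' := hdist j (by simp at hj; omega)
    rw [hij] at hi'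
    omega
  calc ∑ i ∈ Finset.range L, (f (x (i + 1)) - f (x i)) ^ 2
      ≤ ∑ i ∈ Finset.range L, ∑ y, (if G.Adj (x i) y then (f (x i) - f y) ^ 2 else 0) := by
        refine Finset.sum_le_sum fun i hi => ?_
        have := Finset.single_le_sum
          (f := fun y => if G.Adj (x i) y then (f (x i) - f y) ^ 2 else 0)
          (fun y _ => by split_ifs <;> positivity) (Finset.mem_univ (x (i + 1)))
        simp only [hadj i (Finset.mem_range.1 hi), if_true] at this
        linarith [this, sub_sq_comm (f (x i)) (f (x (i + 1)))]
    _ ≤ gradSq G f := by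
        classical
        rw [← Finset.sum_image (f := fun z => ∑ y, if G.Adj z y then (f z - f y) ^ 2 else 0) hinj]
        exact Finset.sum_le_sum_of_subset_of_nonneg (Finset.subset_univ _)
          fun x _ _ => Finset.sum_nonneg fun y _ => by split_ifs <;> positivity

/-- Linear growth of balls: before it exhausts the graph, a ball of radius `R` has at least
`R d_min / 3` vertices. -/
lemma mul_minDegree_le_card_ball (hG : G.Connected) {v w : V} {R : ℕ} (hR : R < G.dist v w) :
    R * G.minDegree ≤ 3 * (Finset.univ.filter fun y => G.dist v y ≤ R).card := by
  classical
  obtain ⟨x, -, -, -, hdist⟩ := exists_geodesic hG v w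
  calc R * G.minDegree = ∑ i ∈ Finset.range R, G.minDegree := by simp
    _ ≤ ∑ i ∈ Finset.range R, G.degree (x i) :=
        Finset.sum_le_sum fun i _ => G.minDegree_le_degree _
    _ = ∑ i ∈ Finset.range R, ∑ y, if G.Adj (x i) y then 1 else 0 := by
        refine Finset.sum_congr rfl fun i _ => ?_
        rw [← SimpleGraph.card_neighborFinset_eq_degree, SimpleGraph.neighborFinset_eq_filter,
          Finset.card_filter]
    _ = ∑ y, ((Finset.range R).filter fun i => G.Adj (x i) y).card := by
        rw [Finset.sum_comm]
        exact Finset.sum_congr rfl fun y _ => (Finset.card_filter _ _).symm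
    _ ≤ ∑ y, if G.dist v y ≤ R then 3 else 0 := by
        refine Finset.sum_le_sum fun y _ => ?_
        have hsub : ∀ i ∈ (Finset.range R).filter fun i => G.Adj (x i) y,
            i < R ∧ G.dist v y ≤ i + 1 ∧ i ≤ G.dist v y + 1 := by
          intro i hi
          simp only [Finset.mem_filter, Finset.mem_range] at hi
          have hd := hdist i (by omega)
          have h1 := hG.dist_triangle (u := v) (v := x i) (w := y)
          have h2 := hG.dist_triangle (u := v) (v := y) (w := x i)
          have h3 : G.dist (x i) y = 1 := SimpleGraph.dist_eq_one_iff_adj.2 hi.2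
          have h4 : G.dist y (x i) = 1 := SimpleGraph.dist_eq_one_iff_adj.2 hi.2.symm
          omega
        split_ifs with hy
        · refine (Finset.card_le_card (t := Finset.Icc (G.dist v y - 1) (G.dist v y + 1))
            fun i hi => ?_).trans (by simp; omega)
          have := hsub i hi
          simp only [Finset.mem_Icc]
          omega
        · rw [Nat.le_zero, Finset.card_eq_zero, Finset.eq_empty_iff_forall_notMem]
          intro i hi
          have := hsub i hi
          omega
    _ = 3 * (Finset.univ.filter fun y => G.dist v y ≤ R).card := by
        rw [← Finset.sum_filter, Finset.sum_const, smul_eq_mul, mul_comm]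

/-- The energy of a function vanishing at `v` with mean one, from a Poincaré inequality. -/
lemma minDegree_sq_le_of_mean_one (hG : G.Connected) {t : ℝ} (ht : 1 ≤ t)
    (hP : ∀ f : V → ℝ, ∑ x, (G.degree x : ℝ) * f x = 0 →
      ∑ x, (G.degree x : ℝ) * f x ^ 2 ≤ t / 4 * gradSq G f)
    (hmin : 0 < G.minDegree) {f : V → ℝ} {v : V} (hv : f v = 0)
    (hmean : ∑ x, (G.degree x : ℝ) * (f x - 1) = 0) :
    (G.minDegree : ℝ) ^ 2 ≤ 24 * t * gradSq G f ^ 2 := by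
  classical
  have hPf := hP _ hmean
  rw [gradSq_sub_const] at hPf
  set D := gradSq G f
  have hδ : (1 : ℝ) ≤ G.minDegree := by exact_mod_cast hmin
  have hdeg : ∀ x, (G.minDegree : ℝ) ≤ (G.degree x : ℝ) := fun x => by
    exact_mod_cast G.minDegree_le_degree x
  have hball : ∀ (R : ℕ) (w : V), R < G.dist v w → (R : ℝ) * (G.minDegree : ℝ) ≤
      3 * ((Finset.univ.filter fun y => G.dist v y ≤ R).card : ℝ) := fun R w hw => by
    exact_mod_cast mul_minDegree_le_card_ball hG hw
  generalize (G.minDegree : ℝ) = δ at *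
  have hsub : ∀ s : Finset V, ∑ x ∈ s, δ * (f x - 1) ^ 2 ≤ t / 4 * D := fun s =>
    calc ∑ x ∈ s, δ * (f x - 1) ^ 2 ≤ ∑ x ∈ s, (G.degree x : ℝ) * (f x - 1) ^ 2 :=
          Finset.sum_le_sum fun x _ => mul_le_mul_of_nonneg_right (hdeg x) (sq_nonneg _)
      _ ≤ ∑ x, (G.degree x : ℝ) * (f x - 1) ^ 2 :=
          Finset.sum_le_sum_of_subset_of_nonneg (Finset.subset_univ _) fun x _ _ => by positivity
      _ ≤ t / 4 * D := hPf
  have hD : 0 < D := by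
    have h := hsub {v}
    simp only [Finset.sum_singleton, hv] at h
    by_contra hD
    nlinarith
  have hlow : ∀ x, 1 / 2 - f x ^ 2 ≤ (f x - 1) ^ 2 := fun x => by
    nlinarith [sq_nonneg (2 * f x - 1)]
  rcases le_or_gt (4 * D) 1 with h4 | h4
  -- This radius makes `R * D ≤ 1/4`, hence `f ^ 2 ≤ 1/4` on the ball; `4 * D ≤ 1` ensures `R ≥ 1`,
  -- so rounding down costs at most a factor two.
  · set R := ⌊1 / (4 * D)⌋₊
    have hRle : (R : ℝ) ≤ 1 / (4 * D) := Nat.floor_le (by positivity)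
    have hRD : 4 * (R * D) ≤ 1 := by
      rw [le_div_iff₀ (by positivity)] at hRle; linarith
    have hRge : 1 ≤ 8 * (R * D) := by
      have h1 : 1 / (4 * D) < R + 1 := Nat.lt_floor_add_one _
      have h2 : 1 ≤ R := Nat.one_le_floor_iff _ |>.2 (by rw [le_div_iff₀ (by positivity)]; linarith)
      have h3 : (1 : ℝ) ≤ R := by exact_mod_cast h2
      rw [div_lt_iff₀ (by positivity)] at h1
      nlinarith
    have hsmall : ∀ x, G.dist v x ≤ R → f x ^ 2 ≤ 1 / 4 := by
      intro x hx
      have h := sq_le_dist_mul_gradSq hG f v x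
      rw [hv, sub_zero] at h
      have hx' : (G.dist v x : ℝ) ≤ R := by exact_mod_cast hx
      nlinarith [mul_le_mul_of_nonneg_right hx' hD.le]
    -- If the ball were the whole graph, `f` would be at most `1/2` everywhere, against mean one.
    have hex : ∃ w, R < G.dist v w := by
      by_contra! hall
      have : ∑ x, (G.degree x : ℝ) * (f x - 1) < 0 := by
        refine Finset.sum_neg (fun x _ => ?_) ⟨v, Finset.mem_univ v⟩
        have := hsmall x (hall x)
        have := hdeg x
        nlinarith [mul_pos (show (0:ℝ) < G.degree x by linarith)
          (show 0 < 1 - f x by nlinarith)]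
      linarith
    obtain ⟨w, hw⟩ := hex
    have hcard := hball R w hw
    have hS := hsub (Finset.univ.filter fun y => G.dist v y ≤ R)
    have hS' : ((Finset.univ.filter fun y => G.dist v y ≤ R).card : ℝ) * (δ * (1 / 4))
        ≤ t / 4 * D := by
      refine le_trans ?_ hS
      rw [← nsmul_eq_mul, ← Finset.sum_const]
      refine Finset.sum_le_sum fun x hx => mul_le_mul_of_nonneg_left ?_ (by linarith)
      have := hsmall x (Finset.mem_filter.1 hx).2
      have := hlow x
      linarith
    have h1 : R * δ ^ 2 ≤ 3 * t * D := by nlinarith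
    have h2 : (R * D) * δ ^ 2 ≤ 3 * t * D ^ 2 := by nlinarith
    nlinarith [mul_le_mul_of_nonneg_right hRge (sq_nonneg δ)]
  -- Here the radius would be zero. Either `D` already dominates `δ`, or the neighbours of `v`
  -- replace the ball: their values satisfy `∑ f ^ 2 ≤ D < δ / 4`, so on average they stay away from
  -- the mean one.
  · rcases le_or_gt δ (4 * D) with h5 | h5
    · nlinarith [mul_le_mul h5 h5 (by linarith) (by linarith),
        mul_le_mul_of_nonneg_right ht (sq_nonneg D)]
    · have hN := hsub (G.neighborFinset v)
      have hsq : ∑ y ∈ G.neighborFinset v, f y ^ 2 ≤ D := by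
        have := sum_neighbor_sq_le (G := G) f v
        rw [← Finset.sum_filter, ← SimpleGraph.neighborFinset_eq_filter] at this
        simpa [hv] using this
      have hlow' : δ * ((G.degree v : ℝ) / 2 - D) ≤ t / 4 * D := by
        refine le_trans ?_ hN
        rw [← Finset.mul_sum]
        refine mul_le_mul_of_nonneg_left ?_ (by linarith)
        have h6 := Finset.sum_le_sum (s := G.neighborFinset v) fun x _ => hlow x
        rw [Finset.sum_sub_distrib, Finset.sum_const, SimpleGraph.card_neighborFinset_eq_degree,
          nsmul_eq_mul] at h6
        linarith
      have h7 := hdeg v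
      have h8 : δ ^ 2 ≤ t * D := by nlinarith
      nlinarith

lemma eq_of_gradSq_eq_zero (hG : G.Connected) {f : V → ℝ} (hf : gradSq G f = 0)
    (v w : V) : f w = f v := by
  have h := sq_le_dist_mul_gradSq hG f v w
  rw [hf, mul_zero] at h
  nlinarith [pow_eq_zero_iff (two_ne_zero) |>.1 (le_antisymm h (sq_nonneg _))]

lemma sqrt_degree_pos (hpos : ∀ x, 0 < G.degree x) (x : V) : 0 < √(G.degree x : ℝ) :=
  Real.sqrt_pos.2 (by exact_mod_cast hpos x)

variable (G)

lemma sum_adj_left (f : V → ℝ) :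
    (∑ x, ∑ y, if G.Adj x y then f x else 0) = ∑ x, (G.degree x : ℝ) * f x := by
  refine Finset.sum_congr rfl fun x _ => ?_
  rw [← Finset.sum_filter, Finset.sum_const, ← SimpleGraph.neighborFinset_eq_filter,
    SimpleGraph.card_neighborFinset_eq_degree, nsmul_eq_mul]

lemma sum_adj_right (f : V → ℝ) :
    (∑ x, ∑ y, if G.Adj x y then f y else 0) = ∑ x, (G.degree x : ℝ) * f x := by
  rw [Finset.sum_comm, ← sum_adj_left]
  simp only [G.adj_comm]

end Energy

/-! ### Reversibility, the spectrum of the lazy walk, and the Poincaré inequality. -/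

open Matrix in
lemma exists_orthonormal_eigenvectors {V : Type*} [Fintype V] [DecidableEq V] {A : Matrix V V ℝ}
    (hA : A.IsHermitian) :
    ∃ b : V → V → ℝ, (∀ i, A *ᵥ b i = hA.eigenvalues i • b i) ∧ (∀ i, b i ⬝ᵥ b i = 1) ∧
      (∀ i j, i ≠ j → b i ⬝ᵥ b j = 0) ∧
      ∀ x y : V → ℝ, ∑ i, (b i ⬝ᵥ x) * (b i ⬝ᵥ y) = x ⬝ᵥ y := by
  have hinner : ∀ x y : EuclideanSpace ℝ V, inner ℝ x y = x.ofLp ⬝ᵥ y.ofLp := fun x y => by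
    rw [EuclideanSpace.inner_eq_star_dotProduct, dotProduct_comm]; simp
  refine ⟨fun i => (hA.eigenvectorBasis i).ofLp, fun i => hA.mulVec_eigenvectorBasis i,
    fun i => ?_, fun i j hij => ?_, fun x y => ?_⟩
  · rw [← hinner, real_inner_self_eq_norm_sq, hA.eigenvectorBasis.orthonormal.1 i, one_pow]
  · rw [← hinner, hA.eigenvectorBasis.orthonormal.2 hij]
  · have h := hA.eigenvectorBasis.sum_inner_mul_inner (WithLp.toLp 2 x) (WithLp.toLp 2 y)
    simp only [hinner] at h
    rw [← h]
    exact Finset.sum_congr rfl fun i _ => by rw [dotProduct_comm (hA.eigenvectorBasis i).ofLp x]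

section Form

variable {V : Type*} [Fintype V] [DecidableEq V] (G : SimpleGraph V) [DecidableRel G.Adj]

lemma degree_mul_lazyMatrix (x y : V) :
    (G.degree x : ℝ) * lazyMatrix G x y =
      (if x = y then (G.degree x : ℝ) / 2 else 0) + (if G.Adj x y then 1 / 2 else 0) := by
  simp only [lazyMatrix, Matrix.of_apply]
  by_cases hxy : x = y
  · subst hxy
    by_cases h : G.degree x = 0 <;> simp [h]
    ring
  · by_cases hadj : G.Adj x y
    · have h : (G.degree x : ℝ) ≠ 0 := by
        have := (G.degree_pos_iff_exists_adj x).2 ⟨y, hadj⟩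
        positivity
      simp only [hxy, hadj, if_false, if_true]
      field_simp
      ring
    · simp [hxy, hadj]

lemma degree_mul_lazyMatrix_comm (x y : V) :
    (G.degree x : ℝ) * lazyMatrix G x y = (G.degree y : ℝ) * lazyMatrix G y x := by
  rw [degree_mul_lazyMatrix, degree_mul_lazyMatrix]
  simp only [G.adj_comm x y]
  by_cases hxy : x = y
  · subst hxy; rfl
  · simp [hxy, Ne.symm hxy]

/-- The bilinear form of the transition matrix with respect to the degree measure. -/
noncomputable def lazyForm (f g : V → ℝ) : ℝ :=
  ∑ x, ∑ y, (G.degree x : ℝ) * lazyMatrix G x y * f x * g y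

lemma lazyForm_comm (f g : V → ℝ) : lazyForm G f g = lazyForm G g f := by
  rw [lazyForm, Finset.sum_comm, lazyForm]
  refine Finset.sum_congr rfl fun x _ => Finset.sum_congr rfl fun y _ => ?_
  rw [degree_mul_lazyMatrix_comm]
  ring

lemma lazyForm_self (f : V → ℝ) :
    lazyForm G f f = (∑ x, (G.degree x : ℝ) * f x ^ 2) / 2 +
      (∑ x, ∑ y, if G.Adj x y then f x * f y else 0) / 2 := by
  simp only [lazyForm, degree_mul_lazyMatrix, Finset.sum_div, ← Finset.sum_add_distrib]
  refine Finset.sum_congr rfl fun x _ => ?_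
  simp only [add_mul, Finset.sum_add_distrib]
  congr 1
  · simp only [ite_mul, zero_mul, Finset.sum_ite_eq, Finset.mem_univ, if_true]
    ring
  · refine Finset.sum_congr rfl fun y _ => ?_
    split_ifs <;> ring

lemma lazyForm_self_eq_sub_gradSq (f : V → ℝ) :
    lazyForm G f f = ∑ x, (G.degree x : ℝ) * f x ^ 2 - gradSq G f / 4 := by
  have h : gradSq G f = (∑ x, ∑ y, if G.Adj x y then f x ^ 2 else 0)
      + (∑ x, ∑ y, if G.Adj x y then f y ^ 2 else 0)
      - 2 * ∑ x, ∑ y, if G.Adj x y then f x * f y else 0 := by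
    simp only [gradSq, Finset.mul_sum, ← Finset.sum_add_distrib, ← Finset.sum_sub_distrib]
    refine Finset.sum_congr rfl fun x _ => Finset.sum_congr rfl fun y _ => ?_
    split_ifs <;> ring
  rw [sum_adj_left G fun x => f x ^ 2, sum_adj_right G fun x => f x ^ 2] at h
  rw [lazyForm_self, h]
  ring

/-- Laziness enters here: the form is a quarter of the sum of `(f x + f y) ^ 2` over ordered
adjacent pairs. -/
lemma lazyForm_self_nonneg (f : V → ℝ) : 0 ≤ lazyForm G f f := by
  have h : (∑ x, ∑ y, if G.Adj x y then (f x + f y) ^ 2 else 0)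
      = (∑ x, ∑ y, if G.Adj x y then f x ^ 2 else 0)
      + (∑ x, ∑ y, if G.Adj x y then f y ^ 2 else 0)
      + 2 * ∑ x, ∑ y, if G.Adj x y then f x * f y else 0 := by
    simp only [Finset.mul_sum, ← Finset.sum_add_distrib]
    refine Finset.sum_congr rfl fun x _ => Finset.sum_congr rfl fun y _ => ?_
    split_ifs <;> ring
  rw [sum_adj_left G fun x => f x ^ 2, sum_adj_right G fun x => f x ^ 2] at h
  have h0 : 0 ≤ ∑ x, ∑ y, if G.Adj x y then (f x + f y) ^ 2 else 0 :=
    Finset.sum_nonneg fun x _ => Finset.sum_nonneg fun y _ => by split_ifs <;> positivity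
  rw [lazyForm_self]
  linarith

end Form

section Poincare

variable {V : Type*} [Fintype V] [DecidableEq V] {G : SimpleGraph V} [DecidableRel G.Adj]

variable (G) in
/-- The symmetrization `D^{1/2} P D^{-1/2}` of the transition matrix. -/
noncomputable def symmetrized : Matrix V V ℝ :=
  Matrix.of fun x y => √(G.degree x : ℝ) * lazyMatrix G x y * (√(G.degree y : ℝ))⁻¹

variable (hpos : ∀ x, 0 < G.degree x)
include hpos

lemma symmetrized_apply (x y : V) : symmetrized G x y =
    (√(G.degree x : ℝ))⁻¹ * ((G.degree x : ℝ) * lazyMatrix G x y) * (√(G.degree y : ℝ))⁻¹ := by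
  have h := sqrt_degree_pos hpos x
  have h2 := Real.sq_sqrt (show (0 : ℝ) ≤ G.degree x by positivity)
  rw [symmetrized, Matrix.of_apply]
  nth_rw 3 [← h2]
  field_simp

lemma symmetrized_isHermitian : (symmetrized G).IsHermitian := by
  ext x y
  simp only [Matrix.conjTranspose_apply, star_trivial]
  rw [symmetrized_apply hpos, symmetrized_apply hpos, degree_mul_lazyMatrix_comm]
  ring

lemma charpoly_symmetrized : (symmetrized G).charpoly = (lazyMatrix G).charpoly := by
  have h : ∀ x, √(G.degree x : ℝ) ≠ 0 := fun x => (sqrt_degree_pos hpos x).ne'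
  let U : (Matrix V V ℝ)ˣ :=
    ⟨Matrix.diagonal fun x => √(G.degree x : ℝ), Matrix.diagonal fun x => (√(G.degree x : ℝ))⁻¹,
      by rw [Matrix.diagonal_mul_diagonal]; simp [h], by
        rw [Matrix.diagonal_mul_diagonal]; simp [h]⟩
  rw [← Matrix.charpoly_units_conj U (lazyMatrix G)]
  congr 1
  ext x y
  rw [show (U : Matrix V V ℝ)⁻¹ = Matrix.diagonal fun x => (√(G.degree x : ℝ))⁻¹ from
    Matrix.inv_eq_right_inv U.val_inv]
  change symmetrized G x y = (Matrix.diagonal (fun x => √(G.degree x : ℝ)) * lazyMatrix G *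
    Matrix.diagonal fun x => (√(G.degree x : ℝ))⁻¹) x y
  rw [Matrix.mul_diagonal, Matrix.diagonal_mul, symmetrized, Matrix.of_apply]

open Matrix in
lemma dotProduct_symmetrized_mulVec (g : V → ℝ) :
    g ⬝ᵥ (symmetrized G *ᵥ g) =
      g ⬝ᵥ g - gradSq G (fun x => (√(G.degree x : ℝ))⁻¹ * g x) / 4 := by
  have h1 : g ⬝ᵥ (symmetrized G *ᵥ g) = lazyForm G (fun x => (√(G.degree x : ℝ))⁻¹ * g x)
      (fun x => (√(G.degree x : ℝ))⁻¹ * g x) := by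
    simp only [dotProduct, mulVec, lazyForm, Finset.mul_sum]
    refine Finset.sum_congr rfl fun x _ => Finset.sum_congr rfl fun y _ => ?_
    rw [symmetrized_apply hpos]
    ring
  rw [h1, lazyForm_self_eq_sub_gradSq]
  congr 1
  refine Finset.sum_congr rfl fun x _ => ?_
  have h := (sqrt_degree_pos hpos x).ne'
  have h2 := Real.sq_sqrt (show (0 : ℝ) ≤ G.degree x by positivity)
  nth_rw 1 [← h2]
  field_simp

open Matrix in
lemma symmetrized_mulVec_sqrt_degree :
    symmetrized G *ᵥ (fun x => √(G.degree x : ℝ)) = fun x => √(G.degree x : ℝ) := by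
  ext x
  simp only [mulVec, dotProduct, symmetrized, Matrix.of_apply]
  have : ∀ y, √(G.degree x : ℝ) * lazyMatrix G x y * (√(G.degree y : ℝ))⁻¹ * √(G.degree y : ℝ)
      = √(G.degree x : ℝ) * lazyMatrix G x y := fun y => by
    rw [mul_assoc, inv_mul_cancel₀ (sqrt_degree_pos hpos y).ne', mul_one]
  simp only [this, ← Finset.mul_sum, lazyMatrix_row_sum, mul_one]

/-- Similarity preserves the characteristic polynomial, so its sorted roots are the ordered
eigenvalues of `symmetrized G`; `i₀` and `i₁` index positions 0 and 1. At least two vertices exist,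
so the default in `lambdaTwo` is not reached. -/
lemma exists_lambdaTwo_index [Nontrivial V] :
    ∃ i₀ i₁ : V, i₀ ≠ i₁ ∧ lambdaTwo G = (symmetrized_isHermitian hpos).eigenvalues i₁ ∧
      (symmetrized_isHermitian hpos).eigenvalues i₁ ≤
        (symmetrized_isHermitian hpos).eigenvalues i₀ ∧
      ∀ j, j ≠ i₀ → (symmetrized_isHermitian hpos).eigenvalues j ≤
        (symmetrized_isHermitian hpos).eigenvalues i₁ := by
  set hA := symmetrized_isHermitian hpos
  have hcard : 1 < Fintype.card V := Fintype.one_lt_card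
  let e := Fintype.equivOfCardEq (Fintype.card_fin (Fintype.card V)) (β := V)
  have he : ∀ k, hA.eigenvalues (e k) = hA.eigenvalues₀ k := fun k => by
    simp [Matrix.IsHermitian.eigenvalues, e]
  have hl : lambdaTwo G = hA.eigenvalues₀ ⟨1, hcard⟩ := by
    have h := hA.sort_roots_charpoly_eq_eigenvalues₀
    rw [charpoly_symmetrized hpos] at h
    have h' : (lazyMatrix G).charpoly.roots.map (RCLike.re : ℝ → ℝ)
        = (lazyMatrix G).charpoly.roots := by
      simp
    rw [h'] at h
    rw [lambdaTwo, lazyEigenvalues, h]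
    simp [List.getD_eq_getElem?_getD, hcard]
  refine ⟨e ⟨0, by omega⟩, e ⟨1, hcard⟩, by simp, by rw [he, hl], ?_, fun j hj => ?_⟩
  · rw [he, he]
    exact hA.eigenvalues₀_antitone (by simp)
  · obtain ⟨k, rfl⟩ := e.surjective j
    rw [he, he]
    refine hA.eigenvalues₀_antitone ?_
    have : k ≠ ⟨0, by omega⟩ := fun h => hj (by rw [h])
    rw [Fin.le_def]
    have h2 : k.val ≠ 0 := fun h => this (Fin.ext h)
    simp only
    omega

-- An eigenvector with eigenvalue at least one has zero energy after division by `√deg`, so by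
-- connectedness it is a multiple of `√deg`; two orthogonal ones cannot exist. Hence `√deg` spans
-- the line of `b i₀`, and functions of mean zero only see eigenvalues at most `λ₂`.
open Matrix in
lemma lambdaTwo_lt_one_and_poincare [Nontrivial V] (hG : G.Connected) :
    lambdaTwo G < 1 ∧ ∀ f : V → ℝ, ∑ x, (G.degree x : ℝ) * f x = 0 →
      (1 - lambdaTwo G) * ∑ x, (G.degree x : ℝ) * f x ^ 2 ≤ gradSq G f / 4 := by
  set hA := symmetrized_isHermitian hpos
  obtain ⟨i₀, i₁, hne, hlam, h01, hle⟩ := exists_lambdaTwo_index hpos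
  obtain ⟨b, hb, hbn, hbo, hbs⟩ := exists_orthonormal_eigenvectors hA
  set s : V → ℝ := fun x => √(G.degree x : ℝ) with hs
  have hspos : ∀ x, 0 < s x := sqrt_degree_pos hpos
  have hss : ∀ x, s x * s x = G.degree x := fun x => Real.mul_self_sqrt (by positivity)
  have hlt : lambdaTwo G < 1 := by
    by_contra! hge
    have hzero : ∀ i, 1 ≤ hA.eigenvalues i → gradSq G (fun x => (s x)⁻¹ * b i x) = 0 := by
      intro i hi
      have h := dotProduct_symmetrized_mulVec hpos (b i)
      rw [hb, dotProduct_smul, hbn, smul_eq_mul, mul_one] at h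
      have := gradSq_nonneg G (fun x => (s x)⁻¹ * b i x)
      linarith
    have hprop : ∀ i, 1 ≤ hA.eigenvalues i → ∃ c : ℝ, b i = c • s := by
      intro i hi
      refine ⟨(s i₀)⁻¹ * b i i₀, funext fun x => ?_⟩
      have h := eq_of_gradSq_eq_zero hG (hzero i hi) i₀ x
      rw [Pi.smul_apply, smul_eq_mul, ← h]
      have := (hspos x).ne'
      field_simp
    obtain ⟨c₁, hc₁⟩ := hprop i₁ (hlam ▸ hge)
    obtain ⟨c₀, hc₀⟩ := hprop i₀ ((hlam ▸ hge).trans h01)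
    have hn₁ := hbn i₁
    have hn₀ := hbn i₀
    have ho := hbo i₀ i₁ hne
    rw [hc₁] at hn₁ ho
    rw [hc₀] at hn₀ ho
    simp only [dotProduct_smul, smul_dotProduct, smul_eq_mul] at hn₁ hn₀ ho
    have : (c₀ * (c₀ * (s ⬝ᵥ s))) * (c₁ * (c₁ * (s ⬝ᵥ s))) = 0 := by
      linear_combination (c₀ * c₁ * (s ⬝ᵥ s)) * ho
    rw [hn₀, hn₁] at this
    norm_num at this
  refine ⟨hlt, fun f hf => ?_⟩
  set g : V → ℝ := fun x => s x * f x with hg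
  have hsym : ∀ x y : V → ℝ, x ⬝ᵥ (symmetrized G *ᵥ y) = (symmetrized G *ᵥ x) ⬝ᵥ y := by
    intro x y
    have hT : (symmetrized G)ᵀ = symmetrized G := by
      have := hA.eq
      rwa [conjTranspose_eq_transpose_of_trivial] at this
    rw [dotProduct_mulVec, ← mulVec_transpose, hT]
  have hbs0 : ∀ j, j ≠ i₀ → b j ⬝ᵥ s = 0 := by
    intro j hj
    have h := hsym (b j) s
    rw [symmetrized_mulVec_sqrt_degree hpos, hb, smul_dotProduct, smul_eq_mul] at h
    have h2 := hle j hj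
    have h3 : (1 - hA.eigenvalues j) * (b j ⬝ᵥ s) = 0 := by linear_combination h
    rcases mul_eq_zero.1 h3 with h4 | h4
    · linarith
    · exact h4
  have hsg : s ⬝ᵥ g = 0 := by
    rw [← hf]
    exact Finset.sum_congr rfl fun x _ => by rw [hg, ← hss x]; ring
  have hb0g : b i₀ ⬝ᵥ g = 0 := by
    have h1 := hbs s g
    rw [Finset.sum_eq_single i₀ (fun j _ hj => by rw [hbs0 j hj, zero_mul]) (by simp), hsg] at h1
    rcases mul_eq_zero.1 h1 with h2 | h2
    · have h3 := hbs s s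
      rw [Finset.sum_eq_single i₀ (fun j _ hj => by rw [hbs0 j hj, zero_mul]) (by simp), h2,
        zero_mul] at h3
      have h4 : 0 < s ⬝ᵥ s :=
        Finset.sum_pos (fun x _ => mul_pos (hspos x) (hspos x)) ⟨i₀, Finset.mem_univ _⟩
      linarith
    · exact h2
  have hgg : g ⬝ᵥ g = ∑ x, (G.degree x : ℝ) * f x ^ 2 :=
    Finset.sum_congr rfl fun x _ => by rw [hg, ← hss x]; ring
  have hq : g ⬝ᵥ (symmetrized G *ᵥ g) ≤ lambdaTwo G * (g ⬝ᵥ g) := by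
    rw [← hbs g (symmetrized G *ᵥ g), ← hbs g g, Finset.mul_sum]
    refine Finset.sum_le_sum fun j _ => ?_
    rw [hsym, hb, smul_dotProduct, smul_eq_mul]
    by_cases hj : j = i₀
    · rw [hj, hb0g]; simp
    · have := hle j hj
      rw [← hlam] at this
      nlinarith [mul_self_nonneg (b j ⬝ᵥ g)]
  rw [dotProduct_symmetrized_mulVec hpos, hgg] at hq
  have hfg : (fun x => (√(G.degree x : ℝ))⁻¹ * g x) = f := by
    funext x
    exact inv_mul_cancel_left₀ (hspos x).ne' (f x)
  rw [hfg] at hq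
  linarith

end Poincare

/-! ### From the energy bound to the gap of the killed walk. -/

section Gap

variable {V : Type*} [Fintype V] {G : SimpleGraph V} [DecidableRel G.Adj]

/-- Homogeneous form of `minDegree_sq_le_of_mean_one`: `f - f v` is rescaled to mean one by `W / M`.
The constant 5 is an upper bound for `√24`. -/
lemma sq_sum_sub_mul_minDegree_le (hG : G.Connected) {t : ℝ} (ht : 1 ≤ t)
    (hP : ∀ f : V → ℝ, ∑ x, (G.degree x : ℝ) * f x = 0 →
      ∑ x, (G.degree x : ℝ) * f x ^ 2 ≤ t / 4 * gradSq G f)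
    (hmin : 0 < G.minDegree) (f : V → ℝ) (v : V) :
    (∑ x, (G.degree x : ℝ) * (f x - f v)) ^ 2 * G.minDegree ≤
      (∑ x, (G.degree x : ℝ)) ^ 2 * (5 * √t * gradSq G f) := by
  set W := ∑ x, (G.degree x : ℝ) with hW
  set M := ∑ x, (G.degree x : ℝ) * (f x - f v) with hM
  have hD := gradSq_nonneg G f
  rcases eq_or_ne M 0 with h0 | h0
  · rw [h0]; simp only [ne_eq, OfNat.ofNat_ne_zero, not_false_eq_true, zero_pow, zero_mul]
    positivity
  have hWpos : 0 < W := Finset.sum_pos (fun x _ => by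
    exact_mod_cast hmin.trans_le (G.minDegree_le_degree x)) ⟨v, Finset.mem_univ v⟩
  have hgrad : gradSq G (fun x => (f x - f v) * (W / M)) = (W / M) ^ 2 * gradSq G f := by
    rw [gradSq_mul_const G (fun x => f x - f v), gradSq_sub_const]
  have hmean : ∑ x, (G.degree x : ℝ) * ((f x - f v) * (W / M) - 1) = 0 := by
    have : ∀ x, (G.degree x : ℝ) * ((f x - f v) * (W / M) - 1)
        = (G.degree x : ℝ) * (f x - f v) * (W / M) - G.degree x := fun x => by ring
    simp only [this, Finset.sum_sub_distrib, ← Finset.sum_mul, ← hM, ← hW]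
    field_simp
    ring
  have key := minDegree_sq_le_of_mean_one hG ht hP hmin
    (f := fun x => (f x - f v) * (W / M)) (v := v) (by simp) hmean
  rw [hgrad] at key
  have hst := Real.sq_sqrt (show 0 ≤ t by linarith)
  have key2 : (G.minDegree : ℝ) ≤ 5 * √t * ((W / M) ^ 2 * gradSq G f) := by
    refine abs_le_of_sq_le_sq' ?_ (by positivity) |>.2
    rw [mul_pow, mul_pow, hst]
    nlinarith [mul_nonneg (show 0 ≤ t by linarith) (sq_nonneg ((W / M) ^ 2 * gradSq G f))]
  calc M ^ 2 * (G.minDegree : ℝ) ≤ M ^ 2 * (5 * √t * ((W / M) ^ 2 * gradSq G f)) :=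
        mul_le_mul_of_nonneg_left key2 (sq_nonneg _)
    _ = W ^ 2 * (5 * √t * gradSq G f) := by field_simp

/-- Spectral gap of the walk killed at `v`. -/
lemma minDegree_mul_sum_sq_le (hG : G.Connected) {t : ℝ} (ht : 1 ≤ t)
    (hP : ∀ f : V → ℝ, ∑ x, (G.degree x : ℝ) * f x = 0 →
      ∑ x, (G.degree x : ℝ) * f x ^ 2 ≤ t / 4 * gradSq G f)
    (hmin : 0 < G.minDegree) {f : V → ℝ} {v : V} (hv : f v = 0) :
    G.minDegree * ∑ x, (G.degree x : ℝ) * f x ^ 2 ≤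
      20 * √t * (∑ x, (G.degree x : ℝ)) * gradSq G f := by
  set W := ∑ x, (G.degree x : ℝ) with hW
  have hWpos : 0 < W := Finset.sum_pos (fun x _ => by
    exact_mod_cast hmin.trans_le (G.minDegree_le_degree x)) ⟨v, Finset.mem_univ v⟩
  -- The values at `u` and `v` are compared through the mean; `(a + b) ^ 2 ≤ 2 a ^ 2 + 2 b ^ 2`
  -- turns 5 into 20.
  have hpt : ∀ u, f u ^ 2 * G.minDegree ≤ 20 * √t * gradSq G f := by
    intro u
    have h1 := sq_sum_sub_mul_minDegree_le hG ht hP hmin f v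
    have h2 := sq_sum_sub_mul_minDegree_le hG ht hP hmin f u
    have h3 : ∀ z, ∑ x, (G.degree x : ℝ) * (f x - f z) =
        ∑ x, (G.degree x : ℝ) * f x - W * f z := fun z => by
      simp only [mul_sub, Finset.sum_sub_distrib, ← Finset.sum_mul, ← hW]
    rw [h3] at h1 h2
    rw [hv, mul_zero, sub_zero] at h1
    rw [← hW] at h1 h2
    generalize ∑ x, (G.degree x : ℝ) * f x = M at h1 h2
    have hδ : (0 : ℝ) ≤ G.minDegree := Nat.cast_nonneg _
    have h4 : (W * f u) ^ 2 * G.minDegree ≤ W ^ 2 * (20 * √t * gradSq G f) := by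
      have h5 : (W * f u) ^ 2 ≤ 2 * M ^ 2 + 2 * (M - W * f u) ^ 2 := by
        nlinarith [sq_nonneg (2 * M - W * f u)]
      nlinarith [mul_le_mul_of_nonneg_right h5 hδ]
    rw [mul_pow, mul_assoc] at h4
    exact le_of_mul_le_mul_left h4 (by positivity)
  calc G.minDegree * ∑ x, (G.degree x : ℝ) * f x ^ 2
      = ∑ x, (G.degree x : ℝ) * (f x ^ 2 * G.minDegree) := by
        rw [Finset.mul_sum]; exact Finset.sum_congr rfl fun x _ => by ring
    _ ≤ ∑ x, (G.degree x : ℝ) * (20 * √t * gradSq G f) :=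
        Finset.sum_le_sum fun x _ => mul_le_mul_of_nonneg_left (hpt x) (Nat.cast_nonneg _)
    _ = 20 * √t * W * gradSq G f := by rw [← Finset.sum_mul]; ring

lemma sum_degree_pos [Nontrivial V] (hG : G.Connected) : 0 < ∑ x, (G.degree x : ℝ) :=
  Finset.sum_pos (fun x _ => by exact_mod_cast hG.preconnected.degree_pos_of_nontrivial x)
    Finset.univ_nonempty

lemma stationary_eq_ofReal [Nontrivial V] (hG : G.Connected) (v : V) :
    stationary G v = ENNReal.ofReal ((G.degree v : ℝ) / ∑ x, (G.degree x : ℝ)) := by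
  have h : (∑ x, (G.degree x : ℝ)) = ((2 * G.edgeFinset.card : ℕ) : ℝ) := by
    rw [← G.sum_degrees_eq_twice_card_edges]; push_cast; rfl
  have h2 := sum_degree_pos hG
  rw [ENNReal.ofReal_div_of_pos h2, h, ENNReal.ofReal_natCast, ENNReal.ofReal_natCast, stationary]
  push_cast
  rfl

lemma sum_stationary [Nontrivial V] (hG : G.Connected) : ∑ v, stationary G v = 1 := by
  simp only [stationary_eq_ofReal hG]
  rw [← ENNReal.ofReal_sum_of_nonneg fun v _ => div_nonneg (Nat.cast_nonneg _)
    (sum_degree_pos hG).le, ← Finset.sum_div, div_self (sum_degree_pos hG).ne',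
    ENNReal.ofReal_one]

end Gap

/-! ### Relaxation time and the resulting hitting rate. -/

section Relaxation

variable {V : Type*} [Fintype V] [DecidableEq V] [Nontrivial V] {G : SimpleGraph V}
  [DecidableRel G.Adj]

/-- Since the lazy form is nonnegative, energy over four is at most the squared norm; testing the
Poincaré inequality on a centred indicator gives `1 - λ₂ ≤ 1`. -/
lemma one_le_relaxationTime (hG : G.Connected) : 1 ≤ relaxationTime G := by
  have hpos : ∀ x, 0 < G.degree x := fun x => hG.preconnected.degree_pos_of_nontrivial x
  obtain ⟨hlt, hP⟩ := lambdaTwo_lt_one_and_poincare hpos hG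
  obtain ⟨a, b, hab⟩ := exists_pair_ne V
  set W := ∑ x, (G.degree x : ℝ) with hW
  have hdpos : ∀ x, (0 : ℝ) < G.degree x := fun x => by exact_mod_cast hpos x
  have hWpos : 0 < W := Finset.sum_pos (fun x _ => hdpos x) ⟨a, Finset.mem_univ a⟩
  set f : V → ℝ := fun x => (if x = a then 1 else 0) - G.degree a / W with hf
  have hmean : ∑ x, (G.degree x : ℝ) * f x = 0 := by
    simp only [hf, mul_sub, Finset.sum_sub_distrib, ← Finset.sum_mul, ← hW, mul_ite, mul_one,
      mul_zero, Finset.sum_ite_eq', Finset.mem_univ, if_true]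
    field_simp
    ring
  have hN : 0 < ∑ x, (G.degree x : ℝ) * f x ^ 2 := by
    have h2 : f b = -(G.degree a / W) := by simp [hf, hab.symm]
    have h3 : 0 < (G.degree a : ℝ) / W := div_pos (hdpos a) hWpos
    have h4 : 0 < (G.degree b : ℝ) * f b ^ 2 :=
      mul_pos (hdpos b) (by rw [h2, neg_sq]; exact pow_pos h3 2)
    exact h4.trans_le (Finset.single_le_sum (f := fun x => (G.degree x : ℝ) * f x ^ 2)
      (fun x _ => mul_nonneg (Nat.cast_nonneg _) (sq_nonneg _)) (Finset.mem_univ b))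
  have h1 := hP f hmean
  have h2 := lazyForm_self_nonneg G f
  rw [lazyForm_self_eq_sub_gradSq] at h2
  have h3 : 1 - lambdaTwo G ≤ 1 := by
    by_contra! h
    nlinarith
  rw [relaxationTime]
  exact (one_le_div (by linarith)).2 h3

lemma poincare_relaxationTime (hG : G.Connected) (f : V → ℝ)
    (hf : ∑ x, (G.degree x : ℝ) * f x = 0) :
    ∑ x, (G.degree x : ℝ) * f x ^ 2 ≤ relaxationTime G / 4 * gradSq G f := by
  obtain ⟨hlt, hP⟩ := lambdaTwo_lt_one_and_poincare
    (fun x => hG.preconnected.degree_pos_of_nontrivial x) hG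
  have h := hP f hf
  rw [relaxationTime, div_div, div_mul_eq_mul_div, one_mul, le_div_iff₀ (by linarith)]
  linarith

variable (G) in
/-- The rate at which the stationary lazy walk hits any given vertex. -/
noncomputable def hitRate : ℝ :=
  G.minDegree / (80 * √(relaxationTime G) * ∑ x, (G.degree x : ℝ))

lemma hitRate_pos (hG : G.Connected) : 0 < hitRate G := by
  have h1 := sum_degree_pos hG
  have h2 := Real.sqrt_pos.2 (show 0 < relaxationTime G by linarith [one_le_relaxationTime hG])
  have h3 : (0 : ℝ) < G.minDegree := by exact_mod_cast hG.preconnected.minDegree_pos_of_nontrivial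
  rw [hitRate]
  positivity

/-- Lets the chance of starting at `v` count as one further step of decay. -/
lemma hitRate_le (hG : G.Connected) (v : V) :
    hitRate G ≤ G.degree v / ∑ x, (G.degree x : ℝ) := by
  have h1 := sum_degree_pos hG
  have h2 : 1 ≤ √(relaxationTime G) := Real.one_le_sqrt.2 (one_le_relaxationTime hG)
  have h3 : (G.minDegree : ℝ) ≤ G.degree v := by exact_mod_cast G.minDegree_le_degree v
  rw [hitRate]
  refine div_le_div₀ (Nat.cast_nonneg _) h3 h1 ?_
  nlinarith

lemma hitRate_lt_one (hG : G.Connected) : hitRate G < 1 := by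
  obtain ⟨a, b, hab⟩ := exists_pair_ne V
  refine (hitRate_le hG a).trans_lt ((div_lt_one (sum_degree_pos hG)).2 ?_)
  have hb : (0 : ℝ) < G.degree b := by exact_mod_cast hG.preconnected.degree_pos_of_nontrivial b
  exact Finset.single_lt_sum (f := fun x => (G.degree x : ℝ)) hab.symm (Finset.mem_univ a)
    (Finset.mem_univ b) hb fun x _ _ => Nat.cast_nonneg (G.degree x)

lemma lazyForm_self_le (hG : G.Connected) {f : V → ℝ} {v : V} (hv : f v = 0) :
    lazyForm G f f ≤ (1 - hitRate G) * ∑ x, (G.degree x : ℝ) * f x ^ 2 := by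
  have h := minDegree_mul_sum_sq_le hG (one_le_relaxationTime hG) (poincare_relaxationTime hG)
    hG.preconnected.minDegree_pos_of_nontrivial hv
  have h1 := sum_degree_pos hG
  have h2 := Real.sqrt_pos.2 (show 0 < relaxationTime G by linarith [one_le_relaxationTime hG])
  -- The 80 in `hitRate` is the 20 of the killed gap times the 4 in `gradSq G f / 4`.
  have h3 : hitRate G * ∑ x, (G.degree x : ℝ) * f x ^ 2 ≤ gradSq G f / 4 := by
    rw [hitRate, div_mul_eq_mul_div, div_le_iff₀ (by positivity)]
    linarith
  rw [lazyForm_self_eq_sub_gradSq]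
  linarith

end Relaxation

/-! ### Geometric decay of the avoidance probability. -/

section Killed

variable {V : Type*} [Fintype V] [DecidableEq V] (G : SimpleGraph V) [DecidableRel G.Adj]

/-- One step of the lazy walk killed at `v`, acting on functions. -/
noncomputable def killedStep (v : V) (f : V → ℝ) (x : V) : ℝ :=
  if x = v then 0 else ∑ y, lazyMatrix G x y * f y

/-- The probability that the lazy walk from a given vertex avoids `v` up to time `t`. -/
noncomputable def survival (v : V) : ℕ → V → ℝ
  | 0 => fun x => if x = v then 0 else 1
  | t + 1 => killedStep G v (survival v t)

variable {G}

lemma survival_self (v : V) (t : ℕ) : survival G v t v = 0 := by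
  cases t <;> simp [survival, killedStep]

lemma survival_nonneg (v : V) (t : ℕ) (x : V) : 0 ≤ survival G v t x := by
  induction t generalizing x with
  | zero => simp only [survival]; split_ifs <;> norm_num
  | succ t ih =>
    simp only [survival, killedStep]
    split_ifs
    · exact le_rfl
    · exact Finset.sum_nonneg fun y _ => mul_nonneg (lazyMatrix_nonneg G x y) (ih y)

lemma sum_degree_mul_killedStep {f : V → ℝ} {v : V} (hv : f v = 0) (g : V → ℝ) :
    ∑ x, (G.degree x : ℝ) * (f x * killedStep G v g x) = lazyForm G f g := by
  refine Finset.sum_congr rfl fun x _ => ?_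
  simp only [killedStep]
  by_cases hx : x = v
  · simp [hx, hv]
  · simp only [hx, if_false, Finset.mul_sum]
    exact Finset.sum_congr rfl fun y _ => by ring

lemma lazyForm_sub_mul (f g : V → ℝ) (c : ℝ) :
    lazyForm G (fun x => f x - c * g x) (fun x => f x - c * g x) =
      lazyForm G f f - 2 * c * lazyForm G g f + c ^ 2 * lazyForm G g g := by
  have h : lazyForm G (fun x => f x - c * g x) (fun x => f x - c * g x) =
      lazyForm G f f - c * lazyForm G f g - c * lazyForm G g f + c ^ 2 * lazyForm G g g := by
    simp only [lazyForm, Finset.mul_sum, ← Finset.sum_add_distrib, ← Finset.sum_sub_distrib]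
    exact Finset.sum_congr rfl fun x _ => Finset.sum_congr rfl fun y _ => by ring
  rw [h, lazyForm_comm G f g]
  ring

/-- With `Q` the killed step, expand the nonnegative form at `f - lam⁻¹ Q f`. The cross term is the
squared norm of `Q f`, and the gap bounds the last term because `Q f` vanishes at `v`. -/
lemma sum_degree_mul_killedStep_sq_le {lam : ℝ} (hlam : 0 < lam) {v : V}
    (hgap : ∀ f : V → ℝ, f v = 0 →
      lazyForm G f f ≤ lam * ∑ x, (G.degree x : ℝ) * f x ^ 2) (f : V → ℝ) :
    ∑ x, (G.degree x : ℝ) * killedStep G v f x ^ 2 ≤ lam * lazyForm G f f := by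
  have hv : killedStep G v f v = 0 := by simp [killedStep]
  have h1 := lazyForm_self_nonneg G (fun x => f x - lam⁻¹ * killedStep G v f x)
  have h2 := hgap _ hv
  rw [lazyForm_sub_mul, ← sum_degree_mul_killedStep hv f] at h1
  simp only [← sq] at h1
  set N := ∑ x, (G.degree x : ℝ) * killedStep G v f x ^ 2
  have h3 : lam⁻¹ ^ 2 * lazyForm G (killedStep G v f) (killedStep G v f) ≤ lam⁻¹ * N := by
    refine (mul_le_mul_of_nonneg_left h2 (by positivity)).trans_eq ?_
    field_simp
  have h4 : lam⁻¹ * N ≤ lazyForm G f f := by linarith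
  rwa [inv_mul_le_iff₀ hlam] at h4

/-- The killed step is self-adjoint for the degree measure on functions vanishing at `v`, so steps
move from one factor to the other. -/
lemma sum_degree_mul_survival_mul (v : V) (i j : ℕ) :
    ∑ x, (G.degree x : ℝ) * (survival G v i x * survival G v j x) =
      ∑ x, (G.degree x : ℝ) * survival G v (i + j) x := by
  induction i generalizing j with
  | zero =>
    rw [zero_add]
    refine Finset.sum_congr rfl fun x _ => ?_
    by_cases hx : x = v
    · simp [hx, survival_self]
    · simp [survival, hx]
  | succ i ih =>
    rw [show i + 1 + j = i + (j + 1) by ring, ← ih (j + 1)]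
    simp only [survival]
    rw [sum_degree_mul_killedStep (survival_self v i), lazyForm_comm,
      ← sum_degree_mul_killedStep (survival_self v j)]
    exact Finset.sum_congr rfl fun x _ => by ring

/-- Let `h` be the survival function at time `s` and `Q` the killed step. For `t = 2s` the two sums
are `⟨h, Q h⟩` and `⟨h, h⟩`, compared by the gap; for `t = 2s + 1` they are `⟨Q h, Q h⟩` and `⟨h, Q
h⟩`, compared by the previous bound on `Q h`. -/
lemma sum_degree_mul_survival_succ_le {lam : ℝ} (hlam : 0 < lam) {v : V}
    (hgap : ∀ f : V → ℝ, f v = 0 →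
      lazyForm G f f ≤ lam * ∑ x, (G.degree x : ℝ) * f x ^ 2) (t : ℕ) :
    ∑ x, (G.degree x : ℝ) * survival G v (t + 1) x ≤
      lam * ∑ x, (G.degree x : ℝ) * survival G v t x := by
  obtain ⟨s, rfl | rfl⟩ := Nat.even_or_odd' t
  · have h := hgap _ (survival_self (G := G) v s)
    rw [← sum_degree_mul_killedStep (survival_self v s)] at h
    have h1 := sum_degree_mul_survival_mul (G := G) v s (s + 1)
    have h2 := sum_degree_mul_survival_mul (G := G) v s s
    simp only [survival] at h1
    simp only [sq] at h
    rw [h1, h2] at h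
    rwa [two_mul]
  · have h := sum_degree_mul_killedStep_sq_le hlam hgap (survival G v s)
    rw [← sum_degree_mul_killedStep (survival_self v s)] at h
    have h1 := sum_degree_mul_survival_mul (G := G) v s (s + 1)
    have h2 := sum_degree_mul_survival_mul (G := G) v (s + 1) (s + 1)
    simp only [sq] at h
    change ∑ x, (G.degree x : ℝ) * (survival G v (s + 1) x * survival G v (s + 1) x) ≤
      lam * ∑ x, (G.degree x : ℝ) * (survival G v s x * survival G v (s + 1) x) at h
    rw [h1, h2] at h
    rwa [show 2 * s + 1 + 1 = s + 1 + (s + 1) by ring, show 2 * s + 1 = s + (s + 1) by ring]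

lemma sum_stationary_mul_survival_le [Nontrivial V] (hG : G.Connected) (v : V) (t : ℕ) :
    ∑ x, (G.degree x : ℝ) / (∑ y, (G.degree y : ℝ)) * survival G v t x ≤
      Real.exp (-(hitRate G * (t + 1))) := by
  set W := ∑ y, (G.degree y : ℝ) with hW
  have hWpos : 0 < W := sum_degree_pos hG
  have h1 : 0 < 1 - hitRate G := by linarith [hitRate_lt_one hG]
  have hind : ∑ x, (G.degree x : ℝ) * survival G v t x ≤
      (1 - hitRate G) ^ t * (W - G.degree v) := by
    induction t with
    | zero =>
      have : ∀ x, (G.degree x : ℝ) * survival G v 0 x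
          = G.degree x - if x = v then (G.degree x : ℝ) else 0 := fun x => by
        simp only [survival]; split_ifs <;> simp
      simp [this, Finset.sum_sub_distrib, ← hW]
    | succ t ih =>
      refine (sum_degree_mul_survival_succ_le h1 (fun f => lazyForm_self_le hG) t).trans ?_
      rw [pow_succ', mul_assoc]
      exact mul_le_mul_of_nonneg_left ih h1.le
  have h2 : ∑ x, (G.degree x : ℝ) / W * survival G v t x
      = (∑ x, (G.degree x : ℝ) * survival G v t x) / W := by
    rw [Finset.sum_div]; exact Finset.sum_congr rfl fun x _ => by ring
  -- The start already hits `v` with probability at least `hitRate G`, which gives exponent `t + 1`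
  -- instead of `t`. This matters for large `k`: the summed bound then has no additive constant.
  have h3 : (W - G.degree v) / W ≤ 1 - hitRate G := by
    rw [sub_div, div_self hWpos.ne']
    linarith [hitRate_le hG v]
  calc ∑ x, (G.degree x : ℝ) / W * survival G v t x
      ≤ (1 - hitRate G) ^ t * (W - G.degree v) / W := by
        rw [h2]; exact div_le_div_of_nonneg_right hind hWpos.le
    _ ≤ (1 - hitRate G) ^ t * (1 - hitRate G) := by
        rw [mul_div_assoc]; exact mul_le_mul_of_nonneg_left h3 (by positivity)
    _ = (1 - hitRate G) ^ (t + 1) := (pow_succ _ _).symm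
    _ ≤ Real.exp (-hitRate G) ^ (t + 1) :=
        pow_le_pow_left₀ h1.le (Real.one_sub_le_exp_neg _) _
    _ = Real.exp (-(hitRate G * (t + 1))) := by
        rw [← Real.exp_nat_mul]; congr 1; push_cast; ring

end Killed

/-! ### Identification of `survival` with the avoidance probability under the path measure. -/

section Law

variable {V : Type*} [Fintype V] [DecidableEq V] [MeasurableSpace V] [DiscreteMeasurableSpace V]
  {G : SimpleGraph V} [DecidableRel G.Adj]

variable (G) in
instance isProbabilityMeasure_walkLaw (u : V) : IsProbabilityMeasure (walkLaw G u) :=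
  inferInstanceAs (IsProbabilityMeasure (Kernel.traj (X := fun _ => V) (historyKernel G) 0 _))

variable (G) in
instance isProbabilityMeasure_multiWalkLaw {k : ℕ} (u : Fin k → V) :
    IsProbabilityMeasure (multiWalkLaw G u) :=
  inferInstanceAs (IsProbabilityMeasure (Measure.pi _))

lemma lintegral_lazyKernel (x : V) (g : V → ℝ≥0∞) :
    ∫⁻ y, g y ∂(lazyKernel G x) = ∑ y, g y * ENNReal.ofReal (lazyMatrix G x y) := by
  rw [lintegral_fintype]
  refine Finset.sum_congr rfl fun y _ => ?_
  congr 1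
  exact PMF.toMeasure_apply_singleton _ _ (MeasurableSet.singleton y)

/-- The Markov property of the lazy walk. -/
lemma lintegral_walkLaw_mul_succ (u : V) (t : ℕ) (F : (Finset.Iic t → V) → ℝ≥0∞)
    (g : V → ℝ≥0∞) :
    ∫⁻ x, F (Preorder.frestrictLe t x) * g (x (t + 1)) ∂(walkLaw G u) =
      ∫⁻ x, F (Preorder.frestrictLe t x) *
        ∑ y, g y * ENNReal.ofReal (lazyMatrix G (x t) y) ∂(walkLaw G u) := by
  have hF : Measurable F := Measurable.of_discrete
  have hg : Measurable g := Measurable.of_discrete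
  have hH : Measurable fun p : (Finset.Iic t → V) × V => F p.1 * g p.2 := by fun_prop
  have h1 := Kernel.partialTraj_compProd_eq_map_traj (X := fun _ => V) (κ := historyKernel G)
    (Nat.zero_le t) (x₀ := fun _ => u)
  have h2 := Kernel.traj_map_frestrictLe_apply (X := fun _ => V) (κ := historyKernel G) 0 t
    (fun _ => u)
  have h3 : ∫⁻ x, F (Preorder.frestrictLe t x) * g (x (t + 1)) ∂(walkLaw G u) =
      ∫⁻ p, F p.1 * g p.2 ∂((walkLaw G u).map fun x => (Preorder.frestrictLe t x, x (t + 1))) := by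
    rw [lintegral_map hH (by fun_prop)]
  rw [h3, walkLaw, ← h1, Measure.lintegral_compProd hH, ← h2]
  rw [lintegral_map Measurable.of_discrete (by fun_prop)]
  refine lintegral_congr fun x => ?_
  change ∫⁻ y, F (Preorder.frestrictLe t x) * g y ∂(lazyKernel G (x t)) = _
  rw [lintegral_const_mul _ hg, lintegral_lazyKernel]

lemma map_zero_walkLaw (u : V) : ∀ᵐ x ∂(walkLaw G u), x 0 = u := by
  have h2 := Kernel.traj_map_frestrictLe_apply (X := fun _ => V) (κ := historyKernel G) 0 0
    (fun _ => u)
  rw [Kernel.partialTraj_self, Kernel.id_apply] at h2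
  have h : ∀ᵐ w ∂((walkLaw G u).map (Preorder.frestrictLe (π := fun _ => V) 0)),
      w = fun _ => u := by
    rw [walkLaw, h2]
    exact ae_dirac_iff (MeasurableSet.of_discrete) |>.2 rfl
  have h' := ae_of_ae_map (by fun_prop) h
  filter_upwards [h'] with x hx
  exact congrFun hx ⟨0, by simp⟩

/-- The trajectories that avoid `v` up to time `t`. -/
def avoidSet (v : V) (t : ℕ) : Set (ℕ → V) := {x | ∀ s ≤ t, x s ≠ v}

omit [Fintype V] [DecidableEq V] in
lemma measurableSet_avoidSet (v : V) (t : ℕ) : MeasurableSet (avoidSet v t) := by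
  have : avoidSet v t = ⋂ s, ⋂ (_ : s ≤ t), (fun x : ℕ → V => x s) ⁻¹' {v}ᶜ := by
    ext x; simp [avoidSet]
  rw [this]
  exact MeasurableSet.iInter fun s => MeasurableSet.iInter fun _ =>
    (measurable_pi_apply s) (MeasurableSet.of_discrete)

/-- The Markov property moves one step from the path to the function `survival`. Keeping `j` free
makes the induction on `t` work; `j = 0` gives the avoidance probability. -/
lemma lintegral_avoidSet_survival (u v : V) (t j : ℕ) :
    ∫⁻ x, (avoidSet v t).indicator (fun x => ENNReal.ofReal (survival G v j (x t))) x
      ∂(walkLaw G u) = ENNReal.ofReal (survival G v (t + j) u) := by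
  classical
  induction t generalizing j with
  | zero =>
    have h : (avoidSet v 0).indicator (fun x => ENNReal.ofReal (survival G v j (x 0)))
        =ᵐ[walkLaw G u] fun _ => ENNReal.ofReal (survival G v j u) := by
      filter_upwards [map_zero_walkLaw (G := G) u] with x hx
      by_cases hu : u = v
      · rw [Set.indicator_of_notMem (by simp [avoidSet, hx, hu]), hu, survival_self]; simp
      · rw [Set.indicator_of_mem (by simp [avoidSet, hx, hu]), hx]
    rw [lintegral_congr_ae h]
    simp
  | succ t ih =>
    rw [show t + 1 + j = t + (j + 1) by ring, ← ih (j + 1)]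
    let F : (Finset.Iic t → V) → ℝ≥0∞ := fun w => if ∀ i, w i ≠ v then 1 else 0
    have hF : ∀ x : ℕ → V, F (Preorder.frestrictLe t x) = (avoidSet v t).indicator 1 x := by
      intro x
      simp only [F, Set.indicator_apply, avoidSet, Set.mem_ofPred_eq, Pi.one_apply]
      refine if_congr ⟨fun h s hs => h ⟨s, Finset.mem_Iic.2 hs⟩,
        fun h i => h i (Finset.mem_Iic.1 i.2)⟩ rfl rfl
    have h := lintegral_walkLaw_mul_succ (G := G) u t F
      fun y => ENNReal.ofReal (survival G v j y)
    simp only [hF] at h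
    convert h using 2
    · funext x
      by_cases hx : x ∈ avoidSet v t
      · by_cases hx' : x (t + 1) = v
        · rw [Set.indicator_of_notMem (fun h : x ∈ avoidSet v (t + 1) => h (t + 1) le_rfl hx'), hx', survival_self]; simp
        · rw [Set.indicator_of_mem, Set.indicator_of_mem hx, Pi.one_apply, one_mul]
          intro s hs
          rcases Nat.le_succ_iff.1 hs with hs | rfl
          · exact hx s hs
          · exact hx'
      · rw [Set.indicator_of_notMem hx, zero_mul, Set.indicator_of_notMem]
        exact fun h => hx fun s hs => h s (hs.trans t.le_succ)
    · funext x
      by_cases hx : x ∈ avoidSet v t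
      · rw [Set.indicator_of_mem hx, Set.indicator_of_mem hx, Pi.one_apply, one_mul]
        simp only [survival, killedStep, if_neg (hx t le_rfl)]
        rw [ENNReal.ofReal_sum_of_nonneg fun y _ =>
          mul_nonneg (lazyMatrix_nonneg G _ _) (survival_nonneg v j y)]
        refine Finset.sum_congr rfl fun y _ => ?_
        rw [ENNReal.ofReal_mul (lazyMatrix_nonneg G _ _), mul_comm]
      · rw [Set.indicator_of_notMem hx, Set.indicator_of_notMem hx, zero_mul]

lemma walkLaw_avoidSet (u v : V) (t : ℕ) :
    walkLaw G u (avoidSet v t) = ENNReal.ofReal (survival G v t u) := by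
  rw [← add_zero t, ← lintegral_avoidSet_survival, add_zero,
    ← lintegral_indicator_one (measurableSet_avoidSet v t)]
  refine lintegral_congr fun x => ?_
  by_cases hx : x ∈ avoidSet v t
  · rw [Set.indicator_of_mem hx, Set.indicator_of_mem hx]
    simp [survival, hx t le_rfl]
  · rw [Set.indicator_of_notMem hx, Set.indicator_of_notMem hx]

end Law

/-! ### Cover time of `k` walks by a union bound. -/

section Cover

/-- The cover time counts the times at which some vertex is still unvisited by all walks. -/
lemma coverTime_le_tsum {V : Type*} {k : ℕ} (x : Fin k → ℕ → V) :
    ((coverTime x : ℕ∞) : ℝ≥0∞) ≤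
      ∑' t, (⋃ v, Set.univ.pi fun _ : Fin k => avoidSet v t).indicator 1 x := by
  have hn : ∀ n : ℕ, (n : ℕ∞) ≤ coverTime x → (n : ℝ≥0∞) ≤
      ∑' t, (⋃ v, Set.univ.pi fun _ : Fin k => avoidSet v t).indicator 1 x := by
    intro n hn
    refine le_trans ?_ (ENNReal.sum_le_tsum (Finset.range n))
    have : (n : ℝ≥0∞) = ∑ t ∈ Finset.range n, 1 := by simp
    rw [this]
    refine Finset.sum_le_sum fun t ht => ?_
    rw [Set.indicator_of_mem, Pi.one_apply]
    by_contra hx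
    have hcov : coverTime x ≤ t := by
      refine sInf_le ⟨t, rfl, fun v => ?_⟩
      by_contra! hv
      exact hx (Set.mem_iUnion.2 ⟨v, fun i _ s hs => hv i s hs⟩)
    have := hn.trans hcov
    rw [Nat.cast_le] at this
    rw [Finset.mem_range] at ht
    omega
  induction h : coverTime x using ENat.recTopCoe with
  -- If covering never happens, every `n` is a lower bound, so the sum is infinite as well.
  | top =>
    rw [ENat.toENNReal_top, top_le_iff]
    refine ENNReal.eq_top_of_forall_nnreal_le fun r => ?_
    obtain ⟨n, hr⟩ := exists_nat_ge r
    refine le_trans ?_ (hn n (h ▸ le_top))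
    exact_mod_cast hr
  | coe n => exact (by simp : ((n : ℕ∞) : ℝ≥0∞) = n) ▸ hn n h.ge

variable {V : Type*} [Fintype V] [DecidableEq V] [MeasurableSpace V] [DiscreteMeasurableSpace V]
  {G : SimpleGraph V} [DecidableRel G.Adj]

lemma expectedCoverTimeFrom_le_tsum {k : ℕ} (u : Fin k → V) :
    expectedCoverTimeFrom G u ≤
      ∑' t, multiWalkLaw G u (⋃ v, Set.univ.pi fun _ : Fin k => avoidSet v t) := by
  have hm : ∀ t, MeasurableSet (⋃ v : V, Set.univ.pi fun _ : Fin k => avoidSet v t) := fun t =>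
    MeasurableSet.iUnion fun v => MeasurableSet.univ_pi fun _ => measurableSet_avoidSet v t
  refine (lintegral_mono coverTime_le_tsum).trans_eq ?_
  rw [lintegral_tsum fun t => (measurable_one.indicator (hm t)).aemeasurable]
  exact tsum_congr fun t => lintegral_indicator_one (hm t)

lemma sum_prod_mul_multiWalkLaw_le_one (k : ℕ) {p : V → ℝ≥0∞} (hp : ∑ v, p v = 1)
    (s : Set (Fin k → ℕ → V)) : ∑ u : Fin k → V, (∏ i, p (u i)) * multiWalkLaw G u s ≤ 1 :=
  calc ∑ u : Fin k → V, (∏ i, p (u i)) * multiWalkLaw G u s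
      ≤ ∑ u : Fin k → V, (∏ i, p (u i)) :=
        Finset.sum_le_sum fun u _ => mul_le_of_le_one_right' prob_le_one
    _ = 1 := by rw [← Fintype.sum_pow, hp, one_pow]

/-- Union bound over `v`; independence of walks and of starts then factors the average into a `k`-th
power. -/
lemma sum_prod_mul_multiWalkLaw_le (k : ℕ) (p : V → ℝ≥0∞) (t : ℕ) :
    ∑ u : Fin k → V, (∏ i, p (u i)) *
        multiWalkLaw G u (⋃ v, Set.univ.pi fun _ : Fin k => avoidSet v t) ≤
      ∑ v, (∑ x, p x * ENNReal.ofReal (survival G v t x)) ^ k :=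
  calc ∑ u : Fin k → V, (∏ i, p (u i)) *
        multiWalkLaw G u (⋃ v, Set.univ.pi fun _ : Fin k => avoidSet v t)
      ≤ ∑ u : Fin k → V, (∏ i, p (u i)) *
          ∑ v, ∏ i, ENNReal.ofReal (survival G v t (u i)) := by
        refine Finset.sum_le_sum fun u _ => ?_
        gcongr
        refine (measure_iUnion_fintype_le _ _).trans_eq ?_
        refine Finset.sum_congr rfl fun v _ => ?_
        rw [multiWalkLaw, Measure.pi_pi]
        exact Finset.prod_congr rfl fun i _ => walkLaw_avoidSet _ _ _
    _ = ∑ v, (∑ x, p x * ENNReal.ofReal (survival G v t x)) ^ k := by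
        simp only [Finset.mul_sum, ← Finset.prod_mul_distrib, Fintype.sum_pow]
        exact Finset.sum_comm

lemma sum_stationary_mul_multiWalkLaw_le [Nontrivial V] (hG : G.Connected) (k t : ℕ) :
    ∑ u : Fin k → V, (∏ i, stationary G (u i)) *
        multiWalkLaw G u (⋃ v, Set.univ.pi fun _ : Fin k => avoidSet v t) ≤
      ENNReal.ofReal (min 1 (Real.exp (Real.log (Fintype.card V) - k * hitRate G * (t + 1)))) := by
  rw [ENNReal.ofReal_min, ENNReal.ofReal_one]
  refine le_min (sum_prod_mul_multiWalkLaw_le_one k (sum_stationary hG) _)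
    ((sum_prod_mul_multiWalkLaw_le k _ t).trans ?_)
  have h : ∀ v, (∑ x, stationary G x * ENNReal.ofReal (survival G v t x)) ^ k ≤
      ENNReal.ofReal (Real.exp (-(k * hitRate G * (t + 1)))) := by
    intro v
    have h1 : ∀ x, stationary G x * ENNReal.ofReal (survival G v t x) = ENNReal.ofReal
        ((G.degree x : ℝ) / (∑ y, (G.degree y : ℝ)) * survival G v t x) := fun x => by
      rw [stationary_eq_ofReal hG, ENNReal.ofReal_mul
        (div_nonneg (Nat.cast_nonneg _) (sum_degree_pos hG).le)]
    simp only [h1]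
    rw [← ENNReal.ofReal_sum_of_nonneg fun x _ => mul_nonneg
      (div_nonneg (Nat.cast_nonneg _) (sum_degree_pos hG).le) (survival_nonneg v t x)]
    refine (pow_le_pow_left' (ENNReal.ofReal_le_ofReal
      (sum_stationary_mul_survival_le hG v t)) k).trans_eq ?_
    rw [← ENNReal.ofReal_pow (Real.exp_pos _).le, ← Real.exp_nat_mul]
    congr 2
    ring
  refine (Finset.sum_le_sum fun v _ => h v).trans_eq ?_
  rw [Finset.sum_const, Finset.card_univ, sub_eq_add_neg, Real.exp_add,
    Real.exp_log (by exact_mod_cast Fintype.card_pos), ENNReal.ofReal_mul (Nat.cast_nonneg _),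
    ENNReal.ofReal_natCast, nsmul_eq_mul]

end Cover

/-! ### Summing the tail bound. -/

section Tail

/-- The primitive of `y ↦ min 1 (exp y)` that vanishes at `-∞`. -/
noncomputable def minExpPrimitive (x : ℝ) : ℝ := if 0 ≤ x then 1 + x else Real.exp x

lemma minExpPrimitive_nonneg (x : ℝ) : 0 ≤ minExpPrimitive x := by
  rw [minExpPrimitive]
  split_ifs <;> positivity

/-- The function `min 1 (exp y)` is increasing, so its integral over `[x - a, x]` is at least `a`
times its value at the left end. Summed over `t`, these differences telescope. -/
lemma mul_min_exp_le {a : ℝ} (ha : 0 < a) (x : ℝ) :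
    a * min 1 (Real.exp (x - a)) ≤ minExpPrimitive x - minExpPrimitive (x - a) := by
  have hmin1 := min_le_left 1 (Real.exp (x - a))
  have hmin2 := min_le_right 1 (Real.exp (x - a))
  have hE := Real.exp_pos (x - a)
  rw [minExpPrimitive, minExpPrimitive]
  split_ifs with h1 h2 h2
  · nlinarith
  · have h3 := Real.add_one_le_exp (a - x)
    have h4 : Real.exp (a - x) * Real.exp (x - a) = 1 := by
      rw [← Real.exp_add]; simp
    have h5 : (a - x + 1) * Real.exp (x - a) ≤ 1 := by nlinarith
    have h6 : (1 + a) * Real.exp (x - a) ≤ 1 + x := by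
      nlinarith [mul_nonneg (mul_nonneg h1 (show 0 ≤ a - x by linarith)) hE.le,
        mul_le_mul_of_nonneg_left h5 (show 0 ≤ 1 + x by linarith)]
    nlinarith
  · linarith
  · have h3 := Real.add_one_le_exp a
    have h4 : Real.exp x = Real.exp a * Real.exp (x - a) := by
      rw [← Real.exp_add]; congr 1; ring
    nlinarith

lemma tsum_min_exp_le {a L : ℝ} (ha : 0 < a) (hL : 0 ≤ L) :
    ∑' t : ℕ, ENNReal.ofReal (min 1 (Real.exp (L - a * (t + 1)))) ≤
      ENNReal.ofReal ((1 + L) / a) := by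
  refine ENNReal.tsum_le_of_sum_range_le fun n => ?_
  rw [← ENNReal.ofReal_sum_of_nonneg fun t _ => le_min zero_le_one (Real.exp_pos _).le]
  refine ENNReal.ofReal_le_ofReal ?_
  rw [le_div_iff₀ ha, mul_comm, Finset.mul_sum]
  calc ∑ t ∈ Finset.range n, a * min 1 (Real.exp (L - a * (t + 1)))
      ≤ ∑ t ∈ Finset.range n,
        (minExpPrimitive (L - a * t) - minExpPrimitive (L - a * ((t + 1 : ℕ) : ℝ))) := by
        refine Finset.sum_le_sum fun t _ => ?_
        have := mul_min_exp_le ha (L - a * t)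
        rw [show L - a * t - a = L - a * (t + 1) by ring] at this
        push_cast
        exact this
    _ = minExpPrimitive (L - a * (0 : ℕ)) - minExpPrimitive (L - a * n) :=
        Finset.sum_range_sub' (fun t : ℕ => minExpPrimitive (L - a * t)) n
    _ ≤ 1 + L := by
        have := minExpPrimitive_nonneg (L - a * n)
        have h2 : minExpPrimitive (L - a * (0 : ℕ)) = 1 + L := by simp [minExpPrimitive, hL]
        linarith

end Tail

lemma expectedCoverTime_stationary_le {V : Type*} [Fintype V] [DecidableEq V] [Nontrivial V]
    [MeasurableSpace V] [DiscreteMeasurableSpace V] {G : SimpleGraph V} [DecidableRel G.Adj]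
    (hG : G.Connected) {k : ℕ} (hk : 1 ≤ k) :
    expectedCoverTime G k (stationary G) ≤
      ENNReal.ofReal ((1 + Real.log (Fintype.card V)) / (k * hitRate G)) := by
  have hk' : (0 : ℝ) < k := by exact_mod_cast hk
  calc expectedCoverTime G k (stationary G)
      ≤ ∑ u : Fin k → V, (∏ i, stationary G (u i)) *
          ∑' t, multiWalkLaw G u (⋃ v, Set.univ.pi fun _ : Fin k => avoidSet v t) := by
        refine Finset.sum_le_sum fun u _ => ?_
        gcongr
        exact expectedCoverTimeFrom_le_tsum u
    _ = ∑' t, ∑ u : Fin k → V, (∏ i, stationary G (u i)) *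
          multiWalkLaw G u (⋃ v, Set.univ.pi fun _ : Fin k => avoidSet v t) := by
        simp only [← ENNReal.tsum_mul_left]
        exact (Summable.tsum_finsetSum fun _ _ => ENNReal.summable).symm
    _ ≤ ∑' t : ℕ, ENNReal.ofReal
          (min 1 (Real.exp (Real.log (Fintype.card V) - k * hitRate G * (t + 1)))) :=
        ENNReal.tsum_le_tsum fun t => sum_stationary_mul_multiWalkLaw_le hG k t
    _ ≤ _ := tsum_min_exp_le (mul_pos hk' (hitRate_pos hG)) (Real.log_natCast_nonneg _)

end MultiWalk

theorem corollary3p3 :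
    ∃ C : ℝ, 0 < C ∧
      ∀ (V : Type*) [Fintype V] [DecidableEq V] [Nontrivial V]
        [MeasurableSpace V] [DiscreteMeasurableSpace V]
        (G : SimpleGraph V) [DecidableRel G.Adj], G.Connected →
      ∀ k : ℕ, 1 ≤ k →
        MultiWalk.expectedCoverTime G k (MultiWalk.stationary G) ≤
          ENNReal.ofReal
            (C * ((G.edgeFinset.card : ℝ) / ((k : ℝ) * (G.minDegree : ℝ)) *
              Real.sqrt (MultiWalk.relaxationTime G) * Real.log (Fintype.card V : ℝ))) := by
  -- The sum of degrees is `2m`, so `1 / hitRate` contributes 160; `log n ≥ 1/2` gives `1 + log n ≤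
  -- 3 log n`, and `480 = 3 * 160`.
  refine ⟨480, by norm_num, fun V _ _ _ _ _ G _ hG k hk => ?_⟩
  refine (MultiWalk.expectedCoverTime_stationary_le hG hk).trans (ENNReal.ofReal_le_ofReal ?_)
  have hk' : (0 : ℝ) < k := by exact_mod_cast hk
  have hδ : (0 : ℝ) < G.minDegree := by
    exact_mod_cast hG.preconnected.minDegree_pos_of_nontrivial
  have hW : (∑ x, (G.degree x : ℝ)) = 2 * (G.edgeFinset.card : ℝ) := by
    exact_mod_cast G.sum_degrees_eq_twice_card_edges
  have hm := MultiWalk.sum_degree_pos hG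
  have hst := Real.sqrt_pos.2 (show 0 < MultiWalk.relaxationTime G by
    linarith [MultiWalk.one_le_relaxationTime hG])
  have hlog : 1 / 2 ≤ Real.log (Fintype.card V : ℝ) := by
    have h2 : (2 : ℝ) ≤ Fintype.card V := by
      exact_mod_cast (Fintype.one_lt_card : 1 < Fintype.card V)
    linarith [Real.log_le_log (by norm_num) h2, Real.log_two_gt_d9]
  rw [MultiWalk.hitRate, hW]
  rw [hW] at hm
  generalize (G.edgeFinset.card : ℝ) = m at *
  have heq : (1 + Real.log (Fintype.card V)) /
      (k * (G.minDegree / (80 * √(MultiWalk.relaxationTime G) * (2 * m)))) =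
      160 * (m / (k * G.minDegree) * √(MultiWalk.relaxationTime G)) *
        (1 + Real.log (Fintype.card V)) := by
    field_simp
    ring
  have hm0 : 0 < m := by linarith
  have hpos : 0 < m / (k * G.minDegree) * √(MultiWalk.relaxationTime G) := by positivity
  rw [heq]
  nlinarith
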